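/- Let $\mathcal W$ be a finite vocabulary. For each $m$, let $\boldsymbol P_1,\dots,\boldsymbol P_m$ be (possibly random, $m$-dependent) probability distributions on $\mathcal W$, let $\mathcal G_1,\dots,\mathcal G_m\subseteq\mathcal W$ be (possibly random) green lists, and put $P_{t,\mathcal G_t}=\sum_{w\in\mathcal G_t}P_{t,w}$. Real random variables $\zeta_1,\dots,\zeta_m$ are observed. Let $0<p,q<1$ with $q+2p<1$, let $\varepsilon_m=m^{-p}$, and consider the hypotheses - $H_0$: conditionally on $(\boldsymbol P_t,\mathcal G_t)_{t\le m}$, the $\zeta_t$ are i.i.d. $U[0,1]$; - $H_1^{(\mathrm{mix})}$: conditionally on $(\boldsymbol P_t,\mathcal G_t)_{t\le m}$, the $\zeta_t$ are independent with $\zeta_t\sim(1-\varepsilon_m)U[0,1]+\varepsilon_m U[0,P_{t,\mathcal G_t}]$ for $t=1,\dots,m$. Assume that, for all sufficiently large $m$, under $H_1^{(\mathrm{mix})}$ one has $0<P_{t,\mathcal G_t}<1-m^{-q}$ almost surely for all $t=1,\dots,m$. Let $\zeta_{(1)}\le\dots\le\zeta_{(m)}$ be the order statistics and $$\mathrm{HC}^*_m=\max_{1\le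 t\le m}\sqrt m\,\frac{t/m-\zeta_{(t)}}{\sqrt{\zeta_{(t)}(1-\zeta_{(t)})}}.$$ Then, for every constant $\delta>0$, the test that rejects $H_0$ if and only if $\mathrm{HC}^*_m\ge\sqrt{(2+\delta)\log\log m}$ (which uses neither the $\boldsymbol P_t$ nor $\varepsilon_m$) satisfies $$\mathbb P_{H_0}\!\left(\mathrm{HC}^*_m\ge\sqrt{(2+\delta)\log\log m}\right)+\mathbb P_{H_1^{(\mathrm{mix})}}\!\left(\mathrm{HC}^*_m<\sqrt{(2+\delta)\log\log m}\right)\longrightarrow0\qquad(m\to\infty).$$ -/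

import Mathlib

open MeasureTheory ProbabilityTheory Filter Topology

/-- The uniform distribution `U[0, a]` (a probability measure when `0 < a`). -/
noncomputable def unifLaw (a : ℝ) : Measure ℝ := volume[|Set.Icc 0 a]

/-- The mixture `(1 - ε) U[0, 1] + ε U[0, a]`. -/
noncomputable def mixLaw (ε a : ℝ) : Measure ℝ :=
  ENNReal.ofReal (1 - ε) • unifLaw 1 + ENNReal.ofReal ε • unifLaw a

/-- The probability `P_G = ∑_{w ∈ G} P_w` of the green list `G` under the token distribution `P`. -/
noncomputable def greenMass {W : Type*} [Fintype W] (P : stdSimplex ℝ W) (G : Finset W) : ℝ :=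
  ∑ w ∈ G, (P : W → ℝ) w

/-- The sigma-algebra generated by all the token distributions and all the green lists. -/
abbrev envSigma {W Ω : Type*} [Fintype W] {m : ℕ}
    (P : Fin m → Ω → stdSimplex ℝ W) (G : Fin m → Ω → Finset W) : MeasurableSpace Ω :=
  ⨆ t, (MeasurableSpace.comap (P t) inferInstance ⊔ MeasurableSpace.comap (G t) ⊤)

/-- Under `μ`, the token distributions `P t`, the green lists `G t` and the `ζ t` are random
variables and, conditionally on all the token distributions and green lists, the `ζ t` are
independent with `ζ t` distributed as `law (P_{t, G_t})`. -/
structure CondIndepLaw {W Ω : Type*} [Fintype W] [MeasurableSpace Ω] {m : ℕ}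
    (law : ℝ → Measure ℝ) (μ : Measure Ω)
    (P : Fin m → Ω → stdSimplex ℝ W) (G : Fin m → Ω → Finset W) (ζ : Fin m → Ω → ℝ) : Prop where
  measurable_P : ∀ t, Measurable (P t)
  measurable_G : ∀ t, Measurable[_, ⊤] (G t)
  measurable_ζ : ∀ t, Measurable (ζ t)
  cond_law : ∀ A : Set Ω, MeasurableSet[envSigma P G] A →
    ∀ B : Fin m → Set ℝ, (∀ t, MeasurableSet (B t)) →
      μ (A ∩ ⋂ t, ζ t ⁻¹' B t) = ∫⁻ ω in A, ∏ t, law (greenMass (P t ω) (G t ω)) (B t) ∂μ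

/-- The null hypothesis: given the `(P t, G t)`, the `ζ t` are i.i.d. `U[0, 1]`. -/
def NullHyp {W Ω : Type*} [Fintype W] [MeasurableSpace Ω] {m : ℕ} (μ : Measure Ω)
    (P : Fin m → Ω → stdSimplex ℝ W) (G : Fin m → Ω → Finset W) (ζ : Fin m → Ω → ℝ) : Prop :=
  CondIndepLaw (fun _ => unifLaw 1) μ P G ζ

/-- The mixture alternative: given the `(P t, G t)`, the `ζ t` are independent with
`ζ t ∼ (1 - ε) U[0, 1] + ε U[0, P_{t, G_t}]`. -/
def MixHyp {W Ω : Type*} [Fintype W] [MeasurableSpace Ω] {m : ℕ} (ε : ℝ) (μ : Measure Ω)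
    (P : Fin m → Ω → stdSimplex ℝ W) (G : Fin m → Ω → Finset W) (ζ : Fin m → Ω → ℝ) : Prop :=
  CondIndepLaw (fun a => mixLaw ε a) μ P G ζ

/-- The order statistics of `z` in ascending order; index `t` holds the `(t + 1)`-st smallest. -/
noncomputable def orderStat {m : ℕ} (z : Fin m → ℝ) (t : Fin m) : ℝ := z (Tuple.sort z t)

/-- The higher criticism score at the `(t + 1)`-st smallest value. -/
noncomputable def hcScore {m : ℕ} (z : Fin m → ℝ) (t : Fin m) : ℝ :=
  √(m : ℝ) * ((((t : ℕ) + 1 : ℝ) / m - orderStat z t) /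
    √(orderStat z t * (1 - orderStat z t)))

/-- The higher criticism statistic: the maximum of the scores. -/
noncomputable def hcStat {m : ℕ} (z : Fin m → ℝ) : ℝ := ⨆ t : Fin m, hcScore z t

/-- The critical value `√((2 + δ) log log m)`. -/
noncomputable def hcThreshold (δ : ℝ) (m : ℕ) : ℝ :=
  √((2 + δ) * Real.log (Real.log (m : ℝ)))

/-! Both error probabilities are read off the counting process N(x) = #{t : ζ_t ≤ x}: the statistic
reaches a level l ≥ 0 exactly when N(u) ≥ mu + l√(mu(1-u)) for some u in (0,1), provided all sample
points lie in (0,1).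

Null. Put s = mu/(1-u), so that √(mu(1-u)) = √s (1-u), and cut the s-axis into blocks of ratio 1+κ.
On a block the boundary is at least mu + c(1-u) with c constant, which suits the martingale
(N(u)-mu)/(1-u). Bernstein's bound therefore holds uniformly over the block
(`pi_exists_le_countLE_le`). With l² = (2+δ) log log m, all but polynomially many (in l) blocks have
probability at most (log m)^(-β), where β > 1 once κ is small. There are O(log m) blocks, so their
sum vanishes. The few early blocks cost exp(-√l/4) each, and s < 1/l forces a sample point below
1/(lm), which costs 1/l (`pi_exists_standardized_le_explicit`).

Alternative. One point suffices: x = 1 - m^(-q). Every green mass lies below x, so each ζ_t falls in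
(-∞, x] with the same probability x + ε(1-x), whatever the environment. The excess of N(x), in units
of √(m·m^(-q)), is m^γ with γ = (1-q-2p)/2 > 0. It dominates √(log log m), and Chebyshev's
inequality concludes (`MixHyp.measure_le`). -/

/-! ### Counts, order statistics and the score -/

/-- The number of sample values that are at most `x`. -/
noncomputable def countLE {m : ℕ} (z : Fin m → ℝ) (x : ℝ) : ℕ :=
  (Finset.univ.filter fun i => z i ≤ x).card

lemma countLE_le {m : ℕ} (z : Fin m → ℝ) (x : ℝ) : countLE z x ≤ m := by
  simpa [countLE] using Finset.card_filter_le (Finset.univ : Finset (Fin m)) fun i => z i ≤ x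

lemma countLE_mono {m : ℕ} (z : Fin m → ℝ) : Monotone (countLE z) := fun _ _ h =>
  Finset.card_le_card fun i hi => by
    simp only [Finset.mem_filter, Finset.mem_univ, true_and] at hi ⊢
    exact hi.trans h

lemma succ_le_countLE_orderStat {m : ℕ} (z : Fin m → ℝ) (t : Fin m) :
    (t : ℕ) + 1 ≤ countLE z (orderStat z t) := by
  have h : (Finset.Iic t).map (Tuple.sort z).toEmbedding ⊆
      Finset.univ.filter fun i => z i ≤ orderStat z t := by
    intro i hi
    obtain ⟨j, hj, rfl⟩ := Finset.mem_map.1 hi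
    exact Finset.mem_filter.2 ⟨Finset.mem_univ _, Tuple.monotone_sort z (Finset.mem_Iic.1 hj)⟩
  simpa [countLE] using Finset.card_le_card h

lemma orderStat_le_of_lt_countLE {m : ℕ} (z : Fin m → ℝ) (t : Fin m) {x : ℝ}
    (h : (t : ℕ) < countLE z x) : orderStat z t ≤ x := by
  by_contra! hx
  have h' : (Finset.univ.filter fun i => z i ≤ x) ⊆
      (Finset.Iio t).map (Tuple.sort z).toEmbedding := by
    intro i hi
    simp only [Finset.mem_filter, Finset.mem_univ, true_and] at hi
    refine Finset.mem_map.2 ⟨(Tuple.sort z).symm i, ?_, by simp⟩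
    rw [Finset.mem_Iio]
    by_contra! hle
    have := Tuple.monotone_sort z hle
    simp only [Function.comp_apply, Equiv.apply_symm_apply] at this
    exact absurd (hx.trans_le this) (not_lt.2 hi)
  have := Finset.card_le_card h'
  simp only [Finset.card_map, Fin.card_Iio] at this
  exact absurd h (not_lt.2 this)

lemma exists_countLE_of_le_hcStat {m : ℕ} (hm : 0 < m) {z : Fin m → ℝ}
    (hz : ∀ i, z i ∈ Set.Ioo (0 : ℝ) 1) {l : ℝ} (h : l ≤ hcStat z) :
    ∃ u ∈ Set.Ioo (0 : ℝ) 1, (m : ℝ) * u + l * √(m * (u * (1 - u))) ≤ countLE z u := by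
  have : Nonempty (Fin m) := ⟨⟨0, hm⟩⟩
  obtain ⟨t, ht⟩ := exists_eq_ciSup_of_finite (f := hcScore z)
  rw [hcStat, ← ht, hcScore] at h
  obtain ⟨h0, h1⟩ := hz (Tuple.sort z t)
  change 0 < orderStat z t at h0
  change orderStat z t < 1 at h1
  refine ⟨orderStat z t, ⟨h0, h1⟩, ?_⟩
  have hc : ((t : ℕ) + 1 : ℝ) ≤ countLE z (orderStat z t) := by
    exact_mod_cast succ_le_countLE_orderStat z t
  set u := orderStat z t
  refine le_trans ?_ hc
  have hs : 0 < √(u * (1 - u)) := Real.sqrt_pos.2 (mul_pos h0 (sub_pos.2 h1))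
  have hm' : (0 : ℝ) < m := by exact_mod_cast hm
  rw [← mul_div_assoc, le_div_iff₀ hs] at h
  have h2 := mul_le_mul_of_nonneg_left h (Real.sqrt_nonneg (m : ℝ))
  rw [Real.sqrt_mul hm'.le]
  have h3 : √(m : ℝ) * (√(m : ℝ) * (((t : ℕ) + 1 : ℝ) / m - u)) = ((t : ℕ) + 1 : ℝ) - m * u := by
    rw [← mul_assoc, Real.mul_self_sqrt hm'.le]
    field_simp
  rw [h3] at h2
  nlinarith

/-- In quotient form: u ↦ (c-u)/√(u(1-u)) is nonincreasing on (0, c]. Thus moving left from x to the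
nearest sample point, with the count held fixed, can only raise the score. -/
lemma sub_mul_sqrt_le {c u x : ℝ} (hu : 0 ≤ u) (hux : u ≤ x) (hxc : x ≤ c) (hc : c ≤ 1) :
    (c - x) * √(u * (1 - u)) ≤ (c - u) * √(x * (1 - x)) := by
  have h1 : (c - x) * u ≤ (c - u) * x := by nlinarith
  have h2 : (c - x) * (1 - u) ≤ (c - u) * (1 - x) := by nlinarith
  have h3 : ((c - x) * u) * ((c - x) * (1 - u)) ≤ ((c - u) * x) * ((c - u) * (1 - x)) :=
    mul_le_mul h1 h2 (mul_nonneg (by linarith) (by linarith))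
      (mul_nonneg (by linarith) (by linarith))
  rw [← Real.sqrt_sq (sub_nonneg.2 hxc), ← Real.sqrt_sq (sub_nonneg.2 (hux.trans hxc)),
    ← Real.sqrt_mul (sq_nonneg _), ← Real.sqrt_mul (sq_nonneg _)]
  exact Real.sqrt_le_sqrt (by nlinarith)

lemma le_hcStat_of_countLE {m : ℕ} {z : Fin m → ℝ} (hz : ∀ i, z i ∈ Set.Ioo (0 : ℝ) 1)
    {l x : ℝ} (hl : 0 ≤ l) (hx : x ∈ Set.Ioo (0 : ℝ) 1)
    (h : (m : ℝ) * x + l * √(m * (x * (1 - x))) ≤ countLE z x) (hm : 0 < m) :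
    l ≤ hcStat z := by
  have hm' : (0 : ℝ) < m := by exact_mod_cast hm
  have hxs : 0 < √(x * (1 - x)) := Real.sqrt_pos.2 (mul_pos hx.1 (sub_pos.2 hx.2))
  have hpos : 0 < countLE z x := by
    have : (0 : ℝ) < countLE z x := lt_of_lt_of_le (by have := mul_pos hm' hx.1; positivity) h
    exact_mod_cast this
  have hle := countLE_le z x
  -- The largest sample point not exceeding x. Indices start at 0, so its rank is `countLE z x`;
  -- positivity of the count makes the subtraction genuine.
  let t : Fin m := ⟨countLE z x - 1, by omega⟩
  have ht : ((t : ℕ) + 1 : ℝ) = countLE z x := by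
    have : (t : ℕ) + 1 = countLE z x := by simp only [t]; omega
    exact_mod_cast this
  have hu := orderStat_le_of_lt_countLE z t (x := x) (by simp only [t]; omega)
  refine le_trans ?_ (le_ciSup (f := hcScore z) (Set.finite_range _).bddAbove t)
  obtain ⟨h0, h1⟩ := hz (Tuple.sort z t)
  change 0 < orderStat z t at h0
  change orderStat z t < 1 at h1
  rw [hcScore, ht]
  set u := orderStat z t
  have hs : 0 < √(u * (1 - u)) := Real.sqrt_pos.2 (mul_pos h0 (sub_pos.2 h1))
  have hsm : 0 < √(m : ℝ) := Real.sqrt_pos.2 hm'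
  rw [Real.sqrt_mul hm'.le] at h
  have hkey : l * √(x * (1 - x)) ≤ √(m : ℝ) * ((countLE z x : ℝ) / m - x) := by
    have e : (countLE z x : ℝ) - m * x =
        √(m : ℝ) * (√(m : ℝ) * ((countLE z x : ℝ) / m - x)) := by
      rw [← mul_assoc, Real.mul_self_sqrt hm'.le]
      field_simp
    refine le_of_mul_le_mul_left ?_ hsm
    rw [← e]
    linarith
  have hc1 : (countLE z x : ℝ) / m ≤ 1 := by
    rw [div_le_one hm']; exact_mod_cast hle
  have hcx : x ≤ (countLE z x : ℝ) / m := by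
    rw [le_div_iff₀ hm']
    have := mul_nonneg hl (mul_nonneg hsm.le hxs.le)
    linarith
  have hd := sub_mul_sqrt_le h0.le hu hcx hc1
  rw [← mul_div_assoc, le_div_iff₀ hs]
  refine le_of_mul_le_mul_right ?_ hxs
  calc l * √(u * (1 - u)) * √(x * (1 - x)) = l * √(x * (1 - x)) * √(u * (1 - u)) := by ring
    _ ≤ √(m : ℝ) * ((countLE z x : ℝ) / m - x) * √(u * (1 - u)) := by gcongr
    _ = √(m : ℝ) * (((countLE z x : ℝ) / m - x) * √(u * (1 - u))) := by ring
    _ ≤ √(m : ℝ) * (((countLE z x : ℝ) / m - u) * √(x * (1 - x))) := by gcongr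
    _ = _ := by ring

/-! ### A maximal inequality by first passage and change of measure -/

/-- The position of `u` relative to the first `j + 1` grid points. -/
noncomputable def gridCell (x : ℕ → ℝ) (j : ℕ) (u : ℝ) : Fin (j + 1) → Bool :=
  fun k => decide (u ≤ x k)

lemma gridCell_eq_true {x : ℕ → ℝ} {j : ℕ} {u : ℝ} {k : Fin (j + 1)} :
    gridCell x j u k = true ↔ u ≤ x k := by simp [gridCell]

lemma measurable_gridCell (x : ℕ → ℝ) (j : ℕ) : Measurable (gridCell x j) := by
  refine measurable_pi_iff.2 fun k => measurable_to_bool ?_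
  have : (fun u => gridCell x j u k) ⁻¹' {true} = Set.Iic (x k) := by
    ext u
    simp [gridCell]
  rw [this]
  exact measurableSet_Iic

lemma measurableSet_le_countLE (m : ℕ) (K x : ℝ) :
    MeasurableSet {z : Fin m → ℝ | K ≤ countLE z x} := by
  have h : Measurable fun z : Fin m → ℝ => (countLE z x : ℝ) := by
    have e : (fun z : Fin m → ℝ => (countLE z x : ℝ)) =
        fun z => ∑ i, (Set.Iic x).indicator (fun _ => (1 : ℝ)) (z i) := by
      funext z
      simp [countLE, Set.indicator_apply]
    rw [e]
    exact Finset.measurable_sum _ fun i _ =>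
      (measurable_const.indicator measurableSet_Iic).comp (measurable_pi_apply i)
  exact measurableSet_le measurable_const h

/-- A maximal inequality for the counting process: if the product density of `ν'` with respect to
`ν`, conditioned on the counting process up to the time `x j`, is at least `C` as soon as the
boundary `K j` is reached, then the probability that the boundary is ever reached is at most
the total mass of the product of the `ν'` divided by `C`. -/
lemma mul_pi_exists_le_countLE {m : ℕ} (ν ν' : Measure ℝ) [IsFiniteMeasure ν] [IsFiniteMeasure ν']
    {x : ℕ → ℝ} (hx : Monotone x) {a C : ENNReal} {r : ℕ → ENNReal} {K : ℕ → ℝ}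
    (ha : ∀ j, ∀ B ⊆ Set.Iic (x j), MeasurableSet B → a * ν B ≤ ν' B)
    (hr : ∀ j, r j * ν (Set.Ioi (x j)) ≤ ν' (Set.Ioi (x j)))
    (hC : ∀ j n, n ≤ m → K j ≤ n → C ≤ a ^ n * r j ^ (m - n)) :
    C * Measure.pi (fun _ : Fin m => ν) {z | ∃ j, K j ≤ countLE z (x j)} ≤
      ν' Set.univ ^ m := by
  set B : ℕ → Set (Fin m → ℝ) := fun j => {z | K j ≤ countLE z (x j)} with hB
  have hBm : ∀ j, MeasurableSet (B j) := fun j => measurableSet_le_countLE m _ _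
  -- The cells are those below `x j`, where `ν'` has density at least `a`; the single cell above `x
  -- j`, where only the total masses are compared; and inconsistent patterns, which are empty.
  have hcell : ∀ j v, (if v (Fin.last j) = true then a else r j) * ν (gridCell x j ⁻¹' {v}) ≤
      ν' (gridCell x j ⁻¹' {v}) := by
    intro j v
    split_ifs with hv
    · refine ha j _ ?_ (measurable_gridCell x j (measurableSet_singleton _))
      rintro u rfl
      simpa using gridCell_eq_true.1 hv
    · by_cases hk : ∃ k, v k = true
      · obtain ⟨k, hk⟩ := hk
        have : gridCell x j ⁻¹' {v} = ∅ := by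
          refine Set.eq_empty_of_forall_notMem ?_
          rintro u rfl
          refine hv (gridCell_eq_true.2 ((gridCell_eq_true.1 hk).trans (hx ?_)))
          exact_mod_cast Fin.le_last k
        simp [this]
      · push Not at hk
        have : gridCell x j ⁻¹' {v} = Set.Ioi (x j) := by
          ext u
          constructor
          · rintro rfl
            have := mt gridCell_eq_true.2 hv
            simpa using this
          · intro hu
            funext k
            rw [Bool.eq_false_iff.2 (hk k), Bool.eq_false_iff]
            intro h
            have h1 := gridCell_eq_true.1 h
            have h2 : x k ≤ x j := hx (by exact_mod_cast Fin.le_last k)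
            exact absurd (h1.trans h2) (not_le.2 hu)
        rw [this]
        exact hr j
  -- `disjointed B j` is first passage at time j. It depends only on the cells of the grid up to j,
  -- so on it the two product measures are compared cell by cell.
  have hstep : ∀ j, C * Measure.pi (fun _ : Fin m => ν) (disjointed B j) ≤
      Measure.pi (fun _ : Fin m => ν') (disjointed B j) := by
    intro j
    let cnt : (Fin m → Fin (j + 1) → Bool) → Fin (j + 1) → ℕ := fun v k =>
      (Finset.univ.filter fun i => v i k = true).card
    let S : Set (Fin m → Fin (j + 1) → Bool) :=
      {v | K j ≤ cnt v (Fin.last j) ∧ ∀ k : Fin (j + 1), (k : ℕ) < j → ¬ K k ≤ cnt v k}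
    have hcnt : ∀ z k, cnt (fun i => gridCell x j (z i)) k = countLE z (x k) := by
      intro z k
      simp [cnt, countLE, gridCell_eq_true]
    have hS : disjointed B j = (fun z i => gridCell x j (z i)) ⁻¹' S := by
      ext z
      rw [disjointed_apply]
      simp only [Set.mem_sdiff, Finset.sup_set_eq_biUnion, Finset.mem_Iio, Set.mem_iUnion,
        Set.mem_preimage, S, Set.mem_ofPred_eq, hcnt, hB, Fin.val_last, not_exists]
      refine and_congr_right fun _ => ⟨fun h k hk => h k hk, fun h k hk => ?_⟩
      exact h ⟨k, by omega⟩ hk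
    have hmeas : Measurable fun (z : Fin m → ℝ) i => gridCell x j (z i) :=
      measurable_pi_iff.2 fun i => (measurable_gridCell x j).comp (measurable_pi_apply i)
    have hsum : ∀ ρ : Measure ℝ, IsFiniteMeasure ρ →
        Measure.pi (fun _ : Fin m => ρ) (disjointed B j) =
          ∑ v ∈ S.toFinite.toFinset, ∏ i, ρ (gridCell x j ⁻¹' {v i}) := by
      intro ρ _
      rw [hS, ← Measure.map_apply hmeas (S.toFinite.measurableSet),
        Measure.pi_map_pi fun _ => (measurable_gridCell x j).aemeasurable]
      conv_lhs => rw [← S.toFinite.coe_toFinset]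
      rw [← sum_measure_singleton]
      refine Finset.sum_congr rfl fun v _ => ?_
      rw [Measure.pi_singleton]
      exact Finset.prod_congr rfl fun i _ =>
        Measure.map_apply (measurable_gridCell x j) (measurableSet_singleton _)
    rw [hsum ν inferInstance, hsum ν' inferInstance, Finset.mul_sum]
    refine Finset.sum_le_sum fun v hv => ?_
    have hvS : v ∈ S := (Set.Finite.mem_toFinset _).1 hv
    calc C * ∏ i, ν (gridCell x j ⁻¹' {v i})
        ≤ (∏ i, if v i (Fin.last j) = true then a else r j) *
            ∏ i, ν (gridCell x j ⁻¹' {v i}) := by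
          gcongr
          -- With n points at or below `x j`, the likelihood ratio is `a ^ n * r j ^ (m - n)`, and
          -- first passage gives `K j ≤ n`.
          rw [Finset.prod_ite, Finset.prod_const, Finset.prod_const]
          have h1 : (Finset.univ.filter fun i => ¬ v i (Fin.last j) = true).card =
              m - cnt v (Fin.last j) := by
            have := Finset.card_filter_add_card_filter_not (s := (Finset.univ : Finset (Fin m)))
              (fun i => v i (Fin.last j) = true)
            rw [Finset.card_univ, Fintype.card_fin] at this
            simp only [cnt]
            omega
          rw [h1]
          refine hC j _ ?_ hvS.1
          simpa using Finset.card_filter_le (Finset.univ : Finset (Fin m))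
            fun i => v i (Fin.last j) = true
      _ = ∏ i, (if v i (Fin.last j) = true then a else r j) * ν (gridCell x j ⁻¹' {v i}) := by
          rw [Finset.prod_mul_distrib]
      _ ≤ ∏ i, ν' (gridCell x j ⁻¹' {v i}) := Finset.prod_le_prod' fun i _ => hcell j (v i)
  have hU : {z | ∃ j, K j ≤ countLE z (x j)} = ⋃ j, disjointed B j := by
    rw [iUnion_disjointed]
    ext z
    simp [hB]
  rw [hU, measure_iUnion (disjoint_disjointed B) (MeasurableSet.disjointed hBm),
    ← ENNReal.tsum_mul_left]
  calc ∑' j, C * Measure.pi (fun _ : Fin m => ν) (disjointed B j)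
      ≤ ∑' j, Measure.pi (fun _ : Fin m => ν') (disjointed B j) := ENNReal.tsum_le_tsum hstep
    _ = Measure.pi (fun _ : Fin m => ν') (⋃ j, disjointed B j) :=
        (measure_iUnion (disjoint_disjointed B) (MeasurableSet.disjointed hBm)).symm
    _ ≤ Measure.pi (fun _ : Fin m => ν') Set.univ := measure_mono (Set.subset_univ _)
    _ = ν' Set.univ ^ m := by simp [Measure.pi_univ]

/-! ### The uniform law on intervals -/

instance isProbabilityMeasure_unifLaw_one : IsProbabilityMeasure (unifLaw 1) :=
  cond_isProbabilityMeasure_of_finite (by simp) (by simp)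

lemma unifLaw_apply (a : ℝ) (B : Set ℝ) :
    unifLaw a B = (ENNReal.ofReal a)⁻¹ * volume (Set.Icc 0 a ∩ B) := by
  rw [unifLaw, cond_apply measurableSet_Icc]
  simp

lemma unifLaw_one_apply (B : Set ℝ) : unifLaw 1 B = volume (Set.Icc 0 1 ∩ B) := by
  simp [unifLaw_apply]

lemma unifLaw_one_Iic {x : ℝ} (hx : x ≤ 1) : unifLaw 1 (Set.Iic x) = ENNReal.ofReal x := by
  rw [unifLaw_one_apply]
  have : Set.Icc 0 1 ∩ Set.Iic x = Set.Icc 0 x := by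
    ext u
    simp only [Set.mem_inter_iff, Set.mem_Icc, Set.mem_Iic]
    exact ⟨fun h => ⟨h.1.1, h.2⟩, fun h => ⟨⟨h.1, h.2.trans hx⟩, h.2⟩⟩
  simp [this]

lemma unifLaw_one_Ioi {x : ℝ} (hx : 0 ≤ x) :
    unifLaw 1 (Set.Ioi x) = ENNReal.ofReal (1 - x) := by
  rw [unifLaw_one_apply]
  have : Set.Icc 0 1 ∩ Set.Ioi x = Set.Ioc x 1 := by
    ext u
    simp only [Set.mem_inter_iff, Set.mem_Icc, Set.mem_Ioi, Set.mem_Ioc]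
    exact ⟨fun h => ⟨h.2, h.1.2⟩, fun h => ⟨⟨hx.trans h.1.le, h.2⟩, h.1⟩⟩
  simp [this]

lemma unifLaw_one_Ioc {x y : ℝ} (hx : 0 ≤ x) (hy : y ≤ 1) :
    unifLaw 1 (Set.Ioc x y) = ENNReal.ofReal (y - x) := by
  rw [unifLaw_one_apply]
  have : Set.Icc 0 1 ∩ Set.Ioc x y = Set.Ioc x y :=
    Set.inter_eq_right.2 fun u hu => ⟨hx.trans hu.1.le, hu.2.trans hy⟩
  simp [this]

/-! ### Bernstein's inequality, uniformly in time -/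

lemma exp_le_one_add_add_sq_div {w : ℝ} (h0 : 0 ≤ w) (h1 : w < 1) :
    Real.exp w ≤ 1 + w + w ^ 2 / (2 * (1 - w)) := by
  have h := Real.exp_bound' h0 h1.le (n := 3) (by norm_num)
  norm_num [Finset.sum_range_succ, Nat.factorial] at h
  have h2 : w ^ 2 / 2 * (1 + w) ≤ w ^ 2 / (2 * (1 - w)) := by
    rw [le_div_iff₀ (by linarith)]
    nlinarith [sq_nonneg w, mul_nonneg (sq_nonneg w) (sq_nonneg w)]
  nlinarith [pow_nonneg h0 3]

lemma exp_neg_le_one_sub_add_sq {v : ℝ} (hv : 0 ≤ v) :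
    Real.exp (-v) ≤ 1 - v + v ^ 2 / 2 := by
  have h := Real.quadratic_le_exp_of_nonneg hv
  have hpos : 0 < 1 - v + v ^ 2 / 2 := by nlinarith [sq_nonneg (v - 1)]
  rw [Real.exp_neg, inv_le_iff_one_le_mul₀ (Real.exp_pos v)]
  nlinarith [mul_le_mul_of_nonneg_left h hpos.le, sq_nonneg (v ^ 2)]

/-- Bernstein's bound for the moment generating function of a Bernoulli variable. -/
lemma bernoulli_mgf_le {y θ : ℝ} (hy0 : 0 ≤ y) (hy1 : y ≤ 1) (hθ : 0 ≤ θ) (hw : θ * (1 - y) < 1) :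
    1 - y + y * Real.exp θ ≤
      Real.exp (θ * y + y * (1 - y) * θ ^ 2 / (2 * (1 - θ * (1 - y)))) := by
  have hw0 : 0 ≤ θ * (1 - y) := mul_nonneg hθ (by linarith)
  set w := θ * (1 - y) with hwdef
  have hv0 : 0 ≤ θ * y := mul_nonneg hθ hy0
  have e1 := exp_le_one_add_add_sq_div hw0 hw
  have e2 := exp_neg_le_one_sub_add_sq hv0
  have h1w : 0 < 1 - w := by linarith
  have e3 : (θ * y) ^ 2 / 2 ≤ (θ * y) ^ 2 / (2 * (1 - w)) := by
    apply div_le_div_of_nonneg_left (sq_nonneg _) (by linarith) (by linarith)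
  -- The centred variable is -y or 1-y. Both exponentials are bounded to second order, the linear
  -- terms cancel, and 1 + z ≤ exp z finishes.
  have key : (1 - y + y * Real.exp θ) * Real.exp (-(θ * y)) ≤
      Real.exp (y * (1 - y) * θ ^ 2 / (2 * (1 - w))) := by
    have : (1 - y + y * Real.exp θ) * Real.exp (-(θ * y)) =
        (1 - y) * Real.exp (-(θ * y)) + y * Real.exp w := by
      rw [add_mul, mul_assoc y, ← Real.exp_add]
      congr 3
      rw [hwdef]; ring
    rw [this]
    calc (1 - y) * Real.exp (-(θ * y)) + y * Real.exp w
        ≤ (1 - y) * (1 - θ * y + (θ * y) ^ 2 / (2 * (1 - w))) +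
            y * (1 + w + w ^ 2 / (2 * (1 - w))) := by
          have : 0 ≤ 1 - y := by linarith
          gcongr
          linarith
      _ = y * (1 - y) * θ ^ 2 / (2 * (1 - w)) + 1 := by
          field_simp
          rw [hwdef]; ring
      _ ≤ _ := Real.add_one_le_exp _
  rw [Real.exp_add, mul_comm (Real.exp (θ * y))]
  rw [Real.exp_neg, ← div_eq_mul_inv, div_le_iff₀ (Real.exp_pos _)] at key
  exact key

lemma exp_mul_le_one_add {θ t : ℝ} (h0 : 0 ≤ t) (h1 : t ≤ 1) :
    Real.exp (θ * t) ≤ 1 + (Real.exp θ - 1) * t := by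
  have := convexOn_exp.2 (Set.mem_univ (0 : ℝ)) (Set.mem_univ θ) (sub_nonneg.2 h1) h0 (by ring)
  simp only [smul_eq_mul, mul_zero, Real.exp_zero, zero_add] at this
  rw [mul_comm θ t]
  linarith

/-- The tilt has density exp θ up to y and 1 beyond. Given n points up to `x j`, each remaining
point lands below y with chance t = (y - x j)/(1 - x j), and 1 + (exp θ - 1)t ≥ exp(θt) by
convexity. The likelihood ratio at passage is thus at least exp(θ(my + c(1-y))), independently of j.
-/
lemma exp_mul_pi_grid_le {m : ℕ} {x : ℕ → ℝ} (hx : Monotone x) (hx0 : ∀ j, 0 ≤ x j)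
    {y θ c : ℝ} (hxy : ∀ j, x j ≤ y) (hy : y < 1) (hθ : 0 ≤ θ) :
    ENNReal.ofReal (Real.exp (θ * (m * y + c * (1 - y)))) *
      Measure.pi (fun _ : Fin m => unifLaw 1)
        {z | ∃ j, m * x j + c * (1 - x j) ≤ countLE z (x j)} ≤
      ENNReal.ofReal ((1 - y + y * Real.exp θ) ^ m) := by
  have hy0 : 0 ≤ y := (hx0 0).trans (hxy 0)
  have he : 1 ≤ Real.exp θ := Real.one_le_exp hθ
  let ν' : Measure ℝ := ENNReal.ofReal (Real.exp θ) • (unifLaw 1).restrict (Set.Iic y) +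
    (unifLaw 1).restrict (Set.Ioi y)
  have : IsFiniteMeasure ((ENNReal.ofReal (Real.exp θ)) • (unifLaw 1).restrict (Set.Iic y)) :=
    Measure.smul_finite _ ENNReal.ofReal_ne_top
  have : IsFiniteMeasure ν' := by infer_instance
  have hν' : ∀ B, MeasurableSet B → ν' B = ENNReal.ofReal (Real.exp θ) *
      unifLaw 1 (B ∩ Set.Iic y) + unifLaw 1 (B ∩ Set.Ioi y) := fun B hB => by
    simp [ν', Measure.restrict_apply hB]
  have huniv : ν' Set.univ = ENNReal.ofReal (1 - y + y * Real.exp θ) := by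
    rw [hν' _ MeasurableSet.univ, Set.univ_inter, Set.univ_inter, unifLaw_one_Iic hy.le,
      unifLaw_one_Ioi hy0, ← ENNReal.ofReal_mul (by positivity),
      ← ENNReal.ofReal_add (by positivity) (by linarith)]
    congr 1
    ring
  let r : ℕ → ENNReal := fun j =>
    ENNReal.ofReal (1 + (Real.exp θ - 1) * ((y - x j) / (1 - x j)))
  have key := mul_pi_exists_le_countLE (m := m) (unifLaw 1) ν' hx
    (a := ENNReal.ofReal (Real.exp θ))
    (C := ENNReal.ofReal (Real.exp (θ * (m * y + c * (1 - y))))) (r := r)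
    (K := fun j => m * x j + c * (1 - x j)) ?_ ?_ ?_
  · rw [huniv, ← ENNReal.ofReal_pow (by nlinarith)] at key
    exact key
  · intro j B hB hBm
    rw [hν' B hBm, Set.inter_eq_left.2 (hB.trans (Set.Iic_subset_Iic.2 (hxy j)))]
    exact le_self_add
  · intro j
    have h1 : 0 < 1 - x j := by linarith [hxy j]
    rw [hν' _ measurableSet_Ioi, Set.Ioi_inter_Iic, Set.Ioi_inter_Ioi, sup_eq_right.2 (hxy j),
      unifLaw_one_Ioi (hx0 j), unifLaw_one_Ioi hy0, unifLaw_one_Ioc (hx0 j) hy.le,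
      ← ENNReal.ofReal_mul (Real.exp_pos θ).le, ← ENNReal.ofReal_add
        (mul_nonneg (Real.exp_pos _).le (by linarith [hxy j])) (by linarith),
      ← ENNReal.ofReal_mul (by
        have := div_nonneg (sub_nonneg.2 (hxy j)) h1.le
        nlinarith)]
    refine le_of_eq (congrArg _ ?_)
    field_simp
    ring
  · intro j n hn hK
    have h1 : 0 < 1 - x j := by linarith [hxy j]
    have ht0 : 0 ≤ (y - x j) / (1 - x j) := div_nonneg (sub_nonneg.2 (hxy j)) h1.le
    have ht1 : (y - x j) / (1 - x j) ≤ 1 := by rw [div_le_one h1]; linarith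
    have hnn : 0 ≤ 1 + (Real.exp θ - 1) * ((y - x j) / (1 - x j)) := by nlinarith
    rw [← ENNReal.ofReal_pow (Real.exp_pos _).le, ← ENNReal.ofReal_pow hnn,
      ← ENNReal.ofReal_mul (by positivity)]
    refine ENNReal.ofReal_le_ofReal ?_
    calc Real.exp (θ * (m * y + c * (1 - y)))
        ≤ Real.exp (n * θ + (m - n : ℕ) * (θ * ((y - x j) / (1 - x j)))) := by
          rw [Real.exp_le_exp, Nat.cast_sub hn]
          have e : n * θ + ((m : ℝ) - n) * (θ * ((y - x j) / (1 - x j))) =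
              θ * (m * y + ((n - m * x j) / (1 - x j)) * (1 - y)) := by
            field_simp
            ring
          rw [e]
          have : c ≤ (n - m * x j) / (1 - x j) := by
            rw [le_div_iff₀ h1]; linarith
          have : 0 ≤ 1 - y := by linarith
          gcongr
      _ = Real.exp θ ^ n * Real.exp (θ * ((y - x j) / (1 - x j))) ^ (m - n) := by
          rw [Real.exp_add, Real.exp_nat_mul, Real.exp_nat_mul]
      _ ≤ _ := by
          gcongr
          exact exp_mul_le_one_add ht0 ht1

/-- Bernstein's bound holds uniformly over the grid. -/
lemma pi_grid_le {m : ℕ} {x : ℕ → ℝ} (hx : Monotone x) (hx0 : ∀ j, 0 ≤ x j)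
    {y c : ℝ} (hxy : ∀ j, x j ≤ y) (hy0 : 0 < y) (hy : y < 1) (hc : 0 < c) (hm : 0 < m) :
    Measure.pi (fun _ : Fin m => unifLaw 1)
        {z | ∃ j, m * x j + c * (1 - x j) ≤ countLE z (x j)} ≤
      ENNReal.ofReal (Real.exp (-(c ^ 2 / (2 * (m * (y / (1 - y)) + c))))) := by
  have hm' : (0 : ℝ) < m := by exact_mod_cast hm
  have h1y : 0 < 1 - y := by linarith
  set s := m * (y / (1 - y)) with hs
  have hs0 : 0 < s := by positivity
  -- Bernstein's choice: with w = θ(1-y), the exponent is -wc + sw²/(2(1-w)), which equals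
  -- -c²/(2(s+c)) at w = c/(s+c).
  set θ := c / ((s + c) * (1 - y)) with hθ
  have hθ0 : 0 < θ := by positivity
  have hw : θ * (1 - y) = c / (s + c) := by rw [hθ]; field_simp
  have hw1 : θ * (1 - y) < 1 := by rw [hw, div_lt_one (by positivity)]; linarith
  have key := exp_mul_pi_grid_le (m := m) (c := c) hx hx0 hxy hy hθ0.le
  have hb := bernoulli_mgf_le hy0.le hy.le hθ0.le hw1
  have hnn : 0 ≤ 1 - y + y * Real.exp θ := by positivity
  have hpow := pow_le_pow_left₀ hnn hb m
  rw [← Real.exp_nat_mul] at hpow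
  set E := Real.exp (θ * (m * y + c * (1 - y))) with hE
  have hE0 : 0 < E := Real.exp_pos _
  have h2 := key.trans (ENNReal.ofReal_le_ofReal hpow)
  rw [mul_comm, ← ENNReal.le_div_iff_mul_le (by simp [hE0]) (by simp),
    ← ENNReal.ofReal_div_of_pos hE0, hE, ← Real.exp_sub] at h2
  refine h2.trans (ENNReal.ofReal_le_ofReal (Real.exp_le_exp.2 (le_of_eq ?_)))
  rw [hw]
  have hys : m * y = s * (1 - y) := by rw [hs]; field_simp
  have e1 : 1 - c / (s + c) = s / (s + c) := by field_simp; ring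
  rw [e1]
  have e2 : (m : ℝ) * (θ * y + y * (1 - y) * θ ^ 2 / (2 * (s / (s + c)))) =
      θ * (m * y) + (m * y) * (1 - y) * θ ^ 2 / (2 * (s / (s + c))) := by ring
  rw [e2, hys, hθ]
  field_simp
  ring

/-- A maximal form of Bernstein's inequality for the empirical process. -/
lemma pi_exists_le_countLE_le {m : ℕ} (hm : 0 < m) {y c : ℝ} (hy0 : 0 < y) (hy : y < 1)
    (hc : 0 < c) :
    Measure.pi (fun _ : Fin m => unifLaw 1)
        {z | ∃ x ∈ Set.Ioc 0 y, m * x + c * (1 - x) ≤ countLE z x} ≤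
      ENNReal.ofReal (Real.exp (-(c ^ 2 / (2 * (m * (y / (1 - y)) + c))))) := by
  have hm' : (0 : ℝ) < m := by exact_mod_cast hm
  have h1y : 0 < 1 - y := by linarith
  have hstep : ∀ b ∈ Set.Ioo 0 c, Measure.pi (fun _ : Fin m => unifLaw 1)
        {z | ∃ x ∈ Set.Ioc 0 y, m * x + c * (1 - x) ≤ countLE z x} ≤
      ENNReal.ofReal (Real.exp (-(b ^ 2 / (2 * (m * (y / (1 - y)) + b))))) := by
    intro b hb
    -- The mesh is chosen so that rounding x up to the next grid point costs at most (c-b)(1-y), the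
    -- gap between the boundaries with slopes c and b; afterwards b tends to c.
    set d := (c - b) * (1 - y) / m with hd
    have hd0 : 0 < d := div_pos (mul_pos (sub_pos.2 hb.2) h1y) hm'
    let g : ℕ → ℝ := fun j => min (j * d) y
    have hg : Monotone g := fun i j hij => by
      have : (i : ℝ) ≤ j := by exact_mod_cast hij
      simp only [g]
      gcongr
    refine (measure_mono ?_).trans (pi_grid_le hg (fun j => le_min (by positivity) hy0.le)
      (fun j => min_le_right _ _) hy0 hy hb.1 hm)
    rintro z ⟨x, ⟨hx0, hxy⟩, hx⟩
    refine ⟨⌈x / d⌉₊, ?_⟩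
    have h1 : x ≤ g ⌈x / d⌉₊ := by
      refine le_min ?_ hxy
      rw [← div_le_iff₀ hd0]
      exact Nat.le_ceil _
    have h2 : g ⌈x / d⌉₊ ≤ x + d := by
      refine (min_le_left _ _).trans ?_
      have := (Nat.ceil_lt_add_one (div_nonneg hx0.le hd0.le)).le
      calc (⌈x / d⌉₊ : ℝ) * d ≤ (x / d + 1) * d := by gcongr
        _ = x + d := by field_simp
    have h3 : g ⌈x / d⌉₊ ≤ y := min_le_right _ _
    set x' := g ⌈x / d⌉₊
    have h4 : (countLE z x : ℝ) ≤ countLE z x' := by exact_mod_cast countLE_mono z h1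
    have h5 : m * d = (c - b) * (1 - y) := by rw [hd]; field_simp
    have h6 : m * x' ≤ m * x + m * d := by rw [← mul_add]; gcongr
    have h7 : (c - b) * (1 - y) ≤ (c - b) * (1 - x') := by
      have := hb.2
      gcongr
    have h8 : c * (1 - x') ≤ c * (1 - x) := by gcongr
    refine le_trans ?_ h4
    linarith
  have hcont : Tendsto (fun b : ℝ =>
      ENNReal.ofReal (Real.exp (-(b ^ 2 / (2 * (m * (y / (1 - y)) + b)))))) (𝓝[<] c)
      (𝓝 (ENNReal.ofReal (Real.exp (-(c ^ 2 / (2 * (m * (y / (1 - y)) + c))))))) := by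
    refine ENNReal.tendsto_ofReal (Tendsto.mono_left ?_ nhdsWithin_le_nhds)
    have : ContinuousAt (fun b : ℝ =>
      Real.exp (-(b ^ 2 / (2 * (m * (y / (1 - y)) + b))))) c := by
      have : 2 * (m * (y / (1 - y)) + c) ≠ 0 := by positivity
      fun_prop (disch := assumption)
    exact this
  exact ge_of_tendsto hcont (eventually_of_mem (Ioo_mem_nhdsLT hc) hstep)

/-! ### Peeling over geometric blocks -/

lemma pi_exists_le_le (m : ℕ) {x : ℝ} (hx : x ≤ 1) :
    Measure.pi (fun _ : Fin m => unifLaw 1) {z | ∃ i, z i ≤ x} ≤ ENNReal.ofReal (m * x) := by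
  have e : {z : Fin m → ℝ | ∃ i, z i ≤ x} = ⋃ i, Function.eval i ⁻¹' Set.Iic x := by
    ext z; simp
  rw [e]
  refine (measure_iUnion_fintype_le _ _).trans ?_
  have h : ∀ i : Fin m, Measure.pi (fun _ : Fin m => unifLaw 1) (Function.eval i ⁻¹' Set.Iic x) =
      ENNReal.ofReal x := fun i => by
    rw [(measurePreserving_eval (fun _ : Fin m => unifLaw 1) i).measure_preimage
      measurableSet_Iic.nullMeasurableSet, unifLaw_one_Iic hx]
  simp [h, ENNReal.ofReal_mul]

/-- Peeling bound for the maximum of the standardized uniform empirical process. -/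
lemma pi_exists_standardized_le {m K : ℕ} (hm : 0 < m) {l ρ : ℝ} (hl : 1 ≤ l) (hρ : 1 < ρ)
    (hK : (m : ℝ) ^ 2 < ρ ^ (K + 1)) :
    Measure.pi (fun _ : Fin m => unifLaw 1)
        {z | ∃ u ∈ Set.Ioo (0 : ℝ) 1, (m : ℝ) * u + l * √(m * (u * (1 - u))) ≤ countLE z u} ≤
      ENNReal.ofReal (1 / l) + ∑ k ∈ Finset.range (K + 1), ENNReal.ofReal
        (Real.exp (-((l * √(ρ ^ k / l)) ^ 2 / (2 * (ρ * (ρ ^ k / l) + l * √(ρ ^ k / l)))))) := by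
  have hm' : (0 : ℝ) < m := by exact_mod_cast hm
  have hm1 : (1 : ℝ) ≤ m := by exact_mod_cast hm
  have hl0 : 0 < l := by linarith
  have hρ0 : 0 < ρ := by linarith
  -- The right end of block k, obtained by solving m y/(1-y) = ρ·ρ^k/l.
  let y : ℕ → ℝ := fun k => (ρ * (ρ ^ k / l) / m) / (1 + ρ * (ρ ^ k / l) / m)
  have hy0 : ∀ k, 0 < y k := fun k => by simp only [y]; positivity
  have hy1 : ∀ k, y k < 1 := fun k => by
    have : 0 < ρ * (ρ ^ k / l) / m := by positivity
    simp only [y]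
    rw [div_lt_one (by positivity)]
    linarith
  have hyo : ∀ k, m * (y k / (1 - y k)) = ρ * (ρ ^ k / l) := fun k => by
    have : 0 < ρ * (ρ ^ k / l) / m := by positivity
    have h : 1 - y k = 1 / (1 + ρ * (ρ ^ k / l) / m) := by
      simp only [y]
      field_simp
      ring
    rw [h]
    simp only [y]
    field_simp
  have hcover : {z : Fin m → ℝ | ∃ u ∈ Set.Ioo (0 : ℝ) 1,
        (m : ℝ) * u + l * √(m * (u * (1 - u))) ≤ countLE z u} ⊆
      {z | ∃ i, z i ≤ 1 / (l * m)} ∪ ⋃ k ∈ Finset.range (K + 1),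
        {z | ∃ x ∈ Set.Ioc 0 (y k), m * x + l * √(ρ ^ k / l) * (1 - x) ≤ countLE z x} := by
    rintro z ⟨u, ⟨hu0, hu1⟩, hu⟩
    have h1u : 0 < 1 - u := by linarith
    set s := m * (u / (1 - u)) with hs
    have hs0 : 0 < s := by positivity
    have hsq : √(m * (u * (1 - u))) = √s * (1 - u) := by
      rw [← Real.sqrt_sq h1u.le, ← Real.sqrt_mul hs0.le]
      congr 1
      rw [hs, Real.sqrt_sq h1u.le]
      field_simp
    rw [hsq] at hu
    by_cases hcase : s < 1 / l
    · left
      have hpos : 0 < countLE z u := by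
        have h : (0 : ℝ) < countLE z u := lt_of_lt_of_le (by positivity) hu
        exact_mod_cast h
      obtain ⟨i, hi⟩ := Finset.card_pos.1 hpos
      refine ⟨i, (Finset.mem_filter.1 hi).2.trans ?_⟩
      have h1 : m * u ≤ s := by
        rw [hs]
        gcongr
        rw [le_div_iff₀ h1u]
        nlinarith
      rw [← div_div, le_div_iff₀ hm']
      linarith
    · right
      push Not at hcase
      have hls : 1 ≤ l * s := by
        rw [div_le_iff₀ hl0] at hcase
        linarith
      obtain ⟨k, hk1, hk2⟩ := exists_nat_pow_near hls hρ
      -- The count never exceeds m, so l√s ≤ m and ls ≤ m²: only blocks up to K can matter.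
      have hup : l * √s ≤ m := by
        have : (countLE z u : ℝ) ≤ m := by exact_mod_cast countLE_le z u
        have h2 : l * √s * (1 - u) ≤ m * (1 - u) := by linarith
        exact le_of_mul_le_mul_right h2 h1u
      have hlsm : l * s ≤ (m : ℝ) ^ 2 := by
        have h3 : (l * √s) ^ 2 ≤ (m : ℝ) ^ 2 := by gcongr
        rw [mul_pow, Real.sq_sqrt hs0.le] at h3
        nlinarith
      have hkK : k < K + 1 := (pow_lt_pow_iff_right₀ hρ).1 (hk1.trans_lt (hlsm.trans_lt hK))
      refine Set.mem_iUnion₂.2 ⟨k, Finset.mem_range.2 hkK, u, ⟨hu0, ?_⟩, le_trans ?_ hu⟩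
      · have h4 : s ≤ ρ * (ρ ^ k / l) := by
          rw [← mul_div_assoc, le_div_iff₀ hl0, mul_comm ρ, ← pow_succ]
          linarith
        have h5 : u / (1 - u) ≤ ρ * (ρ ^ k / l) / m := by
          rw [le_div_iff₀ hm']
          linarith
        simp only [y]
        rw [div_le_iff₀ h1u] at h5
        rw [le_div_iff₀ (by positivity)]
        linarith
      · have h6 : √(ρ ^ k / l) ≤ √s := by
          refine Real.sqrt_le_sqrt ?_
          rw [div_le_iff₀ hl0]
          linarith
        rw [← mul_assoc]
        gcongr
  refine (measure_mono hcover).trans ((measure_union_le _ _).trans ?_)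
  gcongr
  · refine (pi_exists_le_le m ?_).trans (le_of_eq ?_)
    · rw [div_le_one (by positivity)]
      nlinarith
    · congr 1
      field_simp
  · refine (measure_biUnion_finset_le _ _).trans (Finset.sum_le_sum fun k _ => ?_)
    have := pi_exists_le_countLE_le hm (hy0 k) (hy1 k) (c := l * √(ρ ^ k / l)) (by positivity)
    rwa [hyo] at this

/-- For the early blocks: √(ls) ≥ 1 and ρ ≤ l make both terms ρs and l√s at most l^(3/2) s. -/
lemma exponent_ge_of_one_div_le {l ρ s : ℝ} (hl : 1 ≤ l) (hρ : 1 < ρ) (hlρ : ρ ≤ l)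
    (hs : 1 / l ≤ s) : √l / 4 ≤ (l * √s) ^ 2 / (2 * (ρ * s + l * √s)) := by
  have hl0 : 0 < l := by linarith
  have hs0 : 0 < s := lt_of_lt_of_le (by positivity) hs
  have hr : 0 < √l := Real.sqrt_pos.2 hl0
  have ht : 0 < √s := Real.sqrt_pos.2 hs0
  have hr1 : 1 ≤ √l := Real.one_le_sqrt.2 hl
  have hrt : 1 ≤ √l * √s := by
    rw [← Real.sqrt_mul hl0.le]
    refine Real.one_le_sqrt.2 ?_
    rw [div_le_iff₀ hl0] at hs
    linarith
  have el : l = √l ^ 2 := (Real.sq_sqrt hl0.le).symm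
  have es : s = √s ^ 2 := (Real.sq_sqrt hs0.le).symm
  set r := √l
  set t := √s
  rw [el, es]
  rw [el] at hlρ
  rw [div_le_div_iff₀ (by norm_num) (by positivity)]
  have h1 : ρ ≤ r ^ 3 := by nlinarith [sq_nonneg r]
  have h2 : ρ * t + r ^ 2 ≤ 2 * r ^ 3 * t := by nlinarith [mul_le_mul_of_nonneg_left hrt (sq_nonneg r)]
  have h3 := mul_le_mul_of_nonneg_left h2 (mul_pos hr ht).le
  nlinarith

/-- For the later blocks: the assumption says l√s ≤ κs, so the linear Bernstein correction is
negligible and the Gaussian exponent survives up to 1+2κ. -/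
lemma exponent_ge_of_large {l κ s : ℝ} (hl : 0 < l) (hκ : 0 < κ) (hs : l ^ 2 / κ ^ 2 ≤ s) :
    l ^ 2 / (2 * (1 + 2 * κ)) ≤ (l * √s) ^ 2 / (2 * ((1 + κ) * s + l * √s)) := by
  have hs0 : 0 < s := lt_of_lt_of_le (by positivity) hs
  have h1 : l ≤ κ * √s := by
    rw [← div_le_iff₀' hκ]
    refine Real.le_sqrt_of_sq_le ?_
    rwa [div_pow]
  have h2 : l * √s ≤ κ * s := by
    calc l * √s ≤ κ * √s * √s := by gcongr
      _ = κ * s := by rw [mul_assoc, Real.mul_self_sqrt hs0.le]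
  rw [mul_pow, Real.sq_sqrt hs0.le, div_le_div_iff₀ (by positivity) (by positivity)]
  have h3 := mul_le_mul_of_nonneg_left h2 (sq_nonneg l)
  nlinarith

/-- Explicit bound for the probability that the standardized uniform empirical process
exceeds the level `l`. -/
lemma pi_exists_standardized_le_explicit {m : ℕ} (hm : 0 < m) {l κ : ℝ} (hκ : 0 < κ)
    (hl : 1 + κ ≤ l) :
    Measure.pi (fun _ : Fin m => unifLaw 1)
        {z | ∃ u ∈ Set.Ioo (0 : ℝ) 1, (m : ℝ) * u + l * √(m * (u * (1 - u))) ≤ countLE z u} ≤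
      ENNReal.ofReal (1 / l + ((l / κ) ^ 3 + 1) * Real.exp (-(√l / 4)) +
        (2 * Real.log m / Real.log (1 + κ) + 1) * Real.exp (-(l ^ 2 / (2 * (1 + 2 * κ))))) := by
  have hm1 : (1 : ℝ) ≤ m := by exact_mod_cast hm
  have hl1 : 1 ≤ l := by linarith
  have hl0 : 0 < l := by linarith
  have hlog : 0 < Real.log (1 + κ) := Real.log_pos (by linarith)
  have hlogm : 0 ≤ Real.log m := Real.log_nonneg hm1
  set K := ⌊2 * Real.log m / Real.log (1 + κ)⌋₊ with hKdef
  have hK : (m : ℝ) ^ 2 < (1 + κ) ^ (K + 1) := by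
    rw [← Real.log_lt_log_iff (by positivity) (by positivity), Real.log_pow, Real.log_pow,
      ← div_lt_iff₀ hlog]
    push_cast
    exact Nat.lt_floor_add_one _
  refine (pi_exists_standardized_le hm hl1 (by linarith : 1 < 1 + κ) hK).trans ?_
  rw [← ENNReal.ofReal_sum_of_nonneg fun _ _ => (Real.exp_pos _).le,
    ← ENNReal.ofReal_add (by positivity) (Finset.sum_nonneg fun _ _ => (Real.exp_pos _).le)]
  refine ENNReal.ofReal_le_ofReal ?_
  rw [add_assoc]
  gcongr
  set A := Real.exp (-(√l / 4))
  set B := Real.exp (-(l ^ 2 / (2 * (1 + 2 * κ))))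
  -- From this index on, Bernoulli's inequality gives (1+κ)^k ≥ kκ ≥ l³/κ², hence s = (1+κ)^k/l ≥
  -- l²/κ².
  set n := ⌈(l / κ) ^ 3⌉₊
  have hA : 0 < A := Real.exp_pos _
  have hB : 0 < B := Real.exp_pos _
  have hterm : ∀ k : ℕ, Real.exp (-((l * √((1 + κ) ^ k / l)) ^ 2 /
      (2 * ((1 + κ) * ((1 + κ) ^ k / l) + l * √((1 + κ) ^ k / l))))) ≤
      (if k < n then A else 0) + B := by
    intro k
    split_ifs with hk
    · refine le_add_of_le_of_nonneg (Real.exp_le_exp.2 (neg_le_neg ?_)) hB.le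
      refine exponent_ge_of_one_div_le hl1 (by linarith) hl ?_
      gcongr
      exact one_le_pow₀ (by linarith)
    · rw [zero_add]
      refine Real.exp_le_exp.2 (neg_le_neg (exponent_ge_of_large hl0 hκ ?_))
      have h1 : (l / κ) ^ 3 ≤ k := (Nat.le_ceil _).trans (by exact_mod_cast not_lt.1 hk)
      have h2 : 1 + k * κ ≤ (1 + κ) ^ k := one_add_mul_le_pow (by linarith) k
      rw [le_div_iff₀ hl0]
      calc l ^ 2 / κ ^ 2 * l = (l / κ) ^ 3 * κ := by field_simp
        _ ≤ k * κ := by gcongr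
        _ ≤ (1 + κ) ^ k := by linarith
  refine (Finset.sum_le_sum fun k _ => hterm k).trans ?_
  rw [Finset.sum_add_distrib, Finset.sum_const, Finset.card_range, nsmul_eq_mul]
  gcongr
  · rw [← Finset.sum_filter, Finset.sum_const, nsmul_eq_mul]
    gcongr
    have h1 : ((Finset.range (K + 1)).filter fun k => k < n).card ≤ n := by
      calc _ ≤ (Finset.range n).card := Finset.card_le_card fun k hk => by
            simp only [Finset.mem_filter] at hk
            exact Finset.mem_range.2 hk.2
        _ = n := Finset.card_range n
    calc (((Finset.range (K + 1)).filter fun k => k < n).card : ℝ) ≤ n := by exact_mod_cast h1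
      _ ≤ (l / κ) ^ 3 + 1 := (Nat.ceil_lt_add_one (by positivity)).le
  · push_cast
    gcongr
    exact Nat.floor_le (by positivity)

/-! ### Asymptotics at the critical value -/

lemma tendsto_hcThreshold {δ : ℝ} (hδ : 0 < δ) : Tendsto (hcThreshold δ) atTop atTop := by
  refine Real.tendsto_sqrt_atTop.comp (Tendsto.const_mul_atTop (by linarith) ?_)
  exact Real.tendsto_log_atTop.comp (Real.tendsto_log_atTop.comp tendsto_natCast_atTop_atTop)

lemma eventually_hcThreshold_sq {δ : ℝ} (hδ : 0 < δ) :
    ∀ᶠ m : ℕ in atTop, hcThreshold δ m ^ 2 = (2 + δ) * Real.log (Real.log m) := by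
  have h := (Real.tendsto_log_atTop.comp
    (Real.tendsto_log_atTop.comp (tendsto_natCast_atTop_atTop (R := ℝ)))).eventually_ge_atTop 0
  filter_upwards [h] with m hm
  have hm : 0 ≤ Real.log (Real.log m) := hm
  rw [hcThreshold, Real.sq_sqrt (mul_nonneg (by linarith) hm)]

lemma tendsto_pow_mul_exp_neg_sqrt {κ : ℝ} :
    Tendsto (fun l : ℝ => ((l / κ) ^ 3 + 1) * Real.exp (-(√l / 4))) atTop (𝓝 0) := by
  have h1 : Tendsto (fun l : ℝ => √l / 4) atTop atTop :=
    Real.tendsto_sqrt_atTop.atTop_div_const (by norm_num)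
  have h6 := (Real.tendsto_pow_mul_exp_neg_atTop_nhds_zero 6).comp h1
  have h0 := (Real.tendsto_pow_mul_exp_neg_atTop_nhds_zero 0).comp h1
  have h := (h6.const_mul (4 ^ 6 / κ ^ 3)).add h0
  simp only [mul_zero, add_zero] at h
  refine h.congr' ?_
  filter_upwards [eventually_ge_atTop 0] with l hl
  simp only [Function.comp_apply, pow_zero, one_mul, div_pow]
  have e : √l ^ 6 = l ^ 3 := by
    rw [show 6 = 2 * 3 by norm_num, pow_mul, Real.sq_sqrt hl]
  rw [e]
  ring

lemma tendsto_mul_exp_neg_log {a b β : ℝ} (hβ : 1 < β) :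
    Tendsto (fun X : ℝ => (a * X + b) * Real.exp (-(β * Real.log X))) atTop (𝓝 0) := by
  have h1 := (tendsto_rpow_neg_atTop (sub_pos.2 hβ)).const_mul a
  have h2 := (tendsto_rpow_neg_atTop (zero_lt_one.trans hβ)).const_mul b
  have h := h1.add h2
  simp only [mul_zero, add_zero] at h
  refine h.congr' ?_
  filter_upwards [eventually_gt_atTop 0] with X hX
  have e : Real.exp (-(β * Real.log X)) = X ^ (-β) := by
    rw [Real.rpow_def_of_pos hX]
    ring_nf
  rw [e, show -(β - 1) = 1 + -β by ring, Real.rpow_add hX, Real.rpow_one]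
  ring

/-- Under the uniform law the standardized empirical process stays below the critical value. -/
lemma tendsto_pi_exists_standardized {δ : ℝ} (hδ : 0 < δ) :
    Tendsto (fun m : ℕ => Measure.pi (fun _ : Fin m => unifLaw 1)
        {z | ∃ u ∈ Set.Ioo (0 : ℝ) 1,
          (m : ℝ) * u + hcThreshold δ m * √(m * (u * (1 - u))) ≤ countLE z u}) atTop (𝓝 0) := by
  -- This makes β = (2+δ)/(2+δ/2) > 1, so that log m blocks of probability (log m)^(-β) are summed
  -- to something negligible.
  set κ := δ / 8 with hκdef
  have hκ : 0 < κ := by positivity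
  have hlam := tendsto_hcThreshold hδ
  set β := (2 + δ) / (2 * (1 + 2 * κ)) with hβdef
  have hβ : 1 < β := by
    rw [hβdef, one_lt_div (by positivity), hκdef]
    linarith
  have hlog := Real.tendsto_log_atTop.comp (tendsto_natCast_atTop_atTop (R := ℝ))
  have hlim : Tendsto (fun m : ℕ => 1 / hcThreshold δ m +
      ((hcThreshold δ m / κ) ^ 3 + 1) * Real.exp (-(√(hcThreshold δ m) / 4)) +
      (2 * Real.log m / Real.log (1 + κ) + 1) *
        Real.exp (-(hcThreshold δ m ^ 2 / (2 * (1 + 2 * κ))))) atTop (𝓝 0) := by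
    have h1 : Tendsto (fun m : ℕ => 1 / hcThreshold δ m) atTop (𝓝 0) := by
      simpa [Function.comp_def] using tendsto_inv_atTop_zero.comp hlam
    have h2 := (tendsto_pow_mul_exp_neg_sqrt (κ := κ)).comp hlam
    have h3 := (tendsto_mul_exp_neg_log (a := 2 / Real.log (1 + κ)) (b := 1) hβ).comp hlog
    have h := (h1.add h2).add h3
    simp only [add_zero] at h
    refine h.congr' ?_
    filter_upwards [eventually_hcThreshold_sq hδ] with m hm
    simp only [Function.comp_apply, hm, hβdef]
    congr 2
    · ring
    · congr 1
      ring
  have hlim' := ENNReal.tendsto_ofReal hlim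
  rw [ENNReal.ofReal_zero] at hlim'
  refine tendsto_of_tendsto_of_tendsto_of_le_of_le' tendsto_const_nhds hlim'
    (Eventually.of_forall fun _ => zero_le) ?_
  filter_upwards [hlam.eventually_ge_atTop (1 + κ), eventually_gt_atTop 0] with m hm hm0
  exact pi_exists_standardized_le_explicit hm0 hκ hm

/-! ### Unconditional laws and the null hypothesis -/

/-- Conditional probabilities that are almost surely constant integrate to their product. Under the
alternative the ζ_t need not be unconditionally independent, but this still handles events whose
probability ignores the environment. -/
lemma CondIndepLaw.measure_iInter {W Ω : Type*} [Fintype W] [MeasurableSpace Ω] {m : ℕ}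
    {law : ℝ → Measure ℝ} {μ : Measure Ω} [IsProbabilityMeasure μ]
    {P : Fin m → Ω → stdSimplex ℝ W} {G : Fin m → Ω → Finset W} {ζ : Fin m → Ω → ℝ}
    (h : CondIndepLaw law μ P G ζ) {B : Fin m → Set ℝ} (hB : ∀ t, MeasurableSet (B t))
    {b : Fin m → ENNReal}
    (hb : ∀ t, ∀ᵐ ω ∂μ, law (greenMass (P t ω) (G t ω)) (B t) = b t) :
    μ (⋂ t, ζ t ⁻¹' B t) = ∏ t, b t := by
  have h1 := h.cond_law Set.univ MeasurableSet.univ B hB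
  rw [Set.univ_inter, Measure.restrict_univ] at h1
  rw [h1]
  have h2 : ∀ᵐ ω ∂μ, ∏ t, law (greenMass (P t ω) (G t ω)) (B t) = ∏ t, b t := by
    filter_upwards [ae_all_iff.2 hb] with ω hω
    exact Finset.prod_congr rfl fun t _ => hω t
  rw [lintegral_congr_ae h2]
  simp

lemma NullHyp.map_eq_pi {W Ω : Type*} [Fintype W] [MeasurableSpace Ω] {m : ℕ} {μ : Measure Ω}
    [IsProbabilityMeasure μ] {P : Fin m → Ω → stdSimplex ℝ W} {G : Fin m → Ω → Finset W}
    {ζ : Fin m → Ω → ℝ} (h : NullHyp μ P G ζ) :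
    μ.map (fun ω t => ζ t ω) = Measure.pi fun _ : Fin m => unifLaw 1 := by
  have hmeas : Measurable fun ω t => ζ t ω := measurable_pi_iff.2 h.measurable_ζ
  refine (Measure.pi_eq fun s hs => ?_).symm
  rw [Measure.map_apply hmeas (MeasurableSet.univ_pi hs)]
  have e : (fun ω t => ζ t ω) ⁻¹' Set.univ.pi s = ⋂ t, ζ t ⁻¹' s t := by
    ext ω
    simp
  rw [e]
  exact CondIndepLaw.measure_iInter h hs fun t => ae_of_all _ fun _ => rfl

/-- Off a null set no score has a zero denominator, so the convention x/0 = 0 plays no role. -/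
lemma ae_pi_unifLaw_mem_Ioo {m : ℕ} :
    ∀ᵐ z ∂(Measure.pi fun _ : Fin m => unifLaw 1), ∀ i, z i ∈ Set.Ioo (0 : ℝ) 1 := by
  refine ae_all_iff.2 fun i => ?_
  have h : ∀ᵐ u ∂(unifLaw 1), u ∈ Set.Ioo (0 : ℝ) 1 := by
    rw [ae_iff]
    have : {u : ℝ | u ∉ Set.Ioo (0 : ℝ) 1} = (Set.Ioo (0 : ℝ) 1)ᶜ := rfl
    rw [this, prob_compl_eq_zero_iff measurableSet_Ioo, unifLaw_one_apply,
      Set.inter_eq_right.2 Set.Ioo_subset_Icc_self]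
    simp
  exact (measurePreserving_eval (fun _ : Fin m => unifLaw 1) i).quasiMeasurePreserving.ae h

lemma NullHyp.measure_le {W Ω : Type*} [Fintype W] [MeasurableSpace Ω] {m : ℕ} {μ : Measure Ω}
    [IsProbabilityMeasure μ] {P : Fin m → Ω → stdSimplex ℝ W} {G : Fin m → Ω → Finset W}
    {ζ : Fin m → Ω → ℝ} (h : NullHyp μ P G ζ) (hm : 0 < m) (l : ℝ) :
    μ {ω | l ≤ hcStat fun t => ζ t ω} ≤ Measure.pi (fun _ : Fin m => unifLaw 1)
        {z | ∃ u ∈ Set.Ioo (0 : ℝ) 1, (m : ℝ) * u + l * √(m * (u * (1 - u))) ≤ countLE z u} := by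
  have hmeas : Measurable fun ω t => ζ t ω := measurable_pi_iff.2 h.measurable_ζ
  have hae : ∀ᵐ ω ∂μ, ∀ i, ζ i ω ∈ Set.Ioo (0 : ℝ) 1 := by
    refine ae_of_ae_map hmeas.aemeasurable (p := fun z => ∀ i, z i ∈ Set.Ioo (0 : ℝ) 1) ?_
    rw [h.map_eq_pi]
    exact ae_pi_unifLaw_mem_Ioo
  rw [← h.map_eq_pi]
  -- This inequality holds for outer measure, so the exceedance set need not be shown measurable.
  refine le_trans ?_ (Measure.le_map_apply hmeas.aemeasurable _)
  refine measure_mono_ae ?_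
  filter_upwards [hae] with ω hω hstat
  exact exists_countLE_of_le_hcStat hm hω hstat

/-! ### The alternative: a second-moment bound at one point -/

lemma unifLaw_eq_one {a : ℝ} (ha : 0 < a) {B : Set ℝ} (hB : Set.Ioo 0 a ⊆ B) :
    unifLaw a B = 1 := by
  have h : volume (Set.Icc 0 a ∩ B) = ENNReal.ofReal a := by
    refine le_antisymm ?_ ?_
    · simpa using measure_mono (μ := volume) (Set.inter_subset_left (s := Set.Icc 0 a) (t := B))
    · simpa using measure_mono (μ := volume) (Set.subset_inter Set.Ioo_subset_Icc_self hB)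
  rw [unifLaw_apply a, h]
  exact ENNReal.inv_mul_cancel (by simpa using ha) ENNReal.ofReal_ne_top

lemma mixLaw_eq_one {ε a : ℝ} (h0 : 0 ≤ ε) (h1 : ε ≤ 1) (ha : 0 < a) (ha1 : a ≤ 1) {B : Set ℝ}
    (hB : Set.Ioo 0 1 ⊆ B) : mixLaw ε a B = 1 := by
  simp only [mixLaw, Measure.add_apply, Measure.smul_apply, smul_eq_mul]
  rw [unifLaw_eq_one one_pos hB,
    unifLaw_eq_one ha ((Set.Ioo_subset_Ioo_right ha1).trans hB), mul_one, mul_one,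
    ← ENNReal.ofReal_add (by linarith) h0]
  simp

lemma mixLaw_Iic {ε a x : ℝ} (h0 : 0 ≤ ε) (h1 : ε ≤ 1) (ha : 0 < a) (hax : a ≤ x) (hx : x ≤ 1) :
    mixLaw ε a (Set.Iic x) = ENNReal.ofReal (x + ε * (1 - x)) := by
  have hx0 : 0 ≤ x := ha.le.trans hax
  simp only [mixLaw, Measure.add_apply, Measure.smul_apply, smul_eq_mul]
  rw [unifLaw_one_Iic hx, unifLaw_eq_one (B := Set.Iic x) ha fun u hu => hu.2.le.trans hax, mul_one,
    ← ENNReal.ofReal_mul (by linarith),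
    ← ENNReal.ofReal_add (mul_nonneg (by linarith) hx0) h0]
  congr 1
  ring

/-- Chebyshev's inequality for the number of independent equiprobable events that occur. -/
lemma measure_sum_indicator_le {Ω : Type*} [MeasurableSpace Ω] {μ : Measure Ω}
    [IsProbabilityMeasure μ] {m : ℕ} {s : Fin m → Set Ω} (hs : ∀ t, MeasurableSet (s t))
    (hind : iIndepSet s μ) {p d : ℝ} (hp : 0 ≤ p) (hp1 : p ≤ 1)
    (hμ : ∀ t, μ (s t) = ENNReal.ofReal p) (hd : 0 < d) :
    μ {ω | ∑ t, (s t).indicator (fun _ => (1 : ℝ)) ω ≤ m * p - d} ≤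
      ENNReal.ofReal (m * (1 - p) / d ^ 2) := by
  let X : Fin m → Ω → ℝ := fun t => (s t).indicator fun _ => (1 : ℝ)
  have hXm : ∀ t, Measurable (X t) := fun t => measurable_const.indicator (hs t)
  have hXb : ∀ t, ∀ᵐ ω ∂μ, X t ω ∈ Set.Icc (0 : ℝ) 1 := fun t => ae_of_all _ fun ω => by
    by_cases h : ω ∈ s t <;> simp [X, h]
  have hXL : ∀ t, MemLp (X t) 2 μ := fun t =>
    memLp_of_bounded (hXb t) (hXm t).aestronglyMeasurable 2
  have hE : ∀ t, ∫ ω, X t ω ∂μ = p := fun t => by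
    simp only [X]
    rw [integral_indicator_const _ (hs t), Measure.real, hμ t, ENNReal.toReal_ofReal hp]
    simp
  have hindf : iIndepFun X μ := hind.iIndepFun_indicator
  have hvar : variance (∑ t, X t) μ ≤ m * (1 - p) := by
    rw [IndepFun.variance_sum (fun t _ => hXL t) fun i _ j _ hij => hindf.indepFun hij]
    calc ∑ t, variance (X t) μ ≤ ∑ _t : Fin m, (1 - p) := by
          refine Finset.sum_le_sum fun t _ => ?_
          -- The variance is at most p(1-p); the factor 1-p is kept because p is close to 1 in the
          -- application.
          have := variance_le_sub_mul_sub (hXb t) (hXm t).aemeasurable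
          rw [hE t] at this
          nlinarith
      _ = m * (1 - p) := by simp [mul_sub]
  have hES : ∫ ω, (∑ t, X t) ω ∂μ = m * p := by
    simp only [Finset.sum_apply]
    rw [integral_finsetSum _ fun t _ => (hXL t).integrable (by norm_num)]
    simp [hE]
  have hch := meas_ge_le_variance_div_sq (memLp_finsetSum' Finset.univ fun t _ => hXL t) hd
    (μ := μ)
  rw [hES] at hch
  refine (measure_mono ?_).trans (hch.trans (ENNReal.ofReal_le_ofReal (by gcongr)))
  intro ω hω
  have hω : ∑ t, X t ω ≤ m * p - d := hω
  change d ≤ |(∑ t, X t) ω - m * p|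
  rw [Finset.sum_apply, abs_sub_comm]
  exact le_trans (by linarith) (le_abs_self _)

lemma MixHyp.measure_le {W Ω : Type*} [Fintype W] [MeasurableSpace Ω] {m : ℕ} {μ : Measure Ω}
    [IsProbabilityMeasure μ] {P : Fin m → Ω → stdSimplex ℝ W} {G : Fin m → Ω → Finset W}
    {ζ : Fin m → Ω → ℝ} {ε v l : ℝ} (h : MixHyp ε μ P G ζ) (hm : 0 < m) (hε0 : 0 ≤ ε)
    (hε1 : ε ≤ 1) (hv0 : 0 < v) (hv1 : v < 1)
    (hP : ∀ t, ∀ᵐ ω ∂μ, 0 < greenMass (P t ω) (G t ω) ∧ greenMass (P t ω) (G t ω) < 1 - v)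
    (hl : 0 ≤ l) (hlt : l < ε * √(m * v)) :
    μ {ω | ¬ l ≤ hcStat fun t => ζ t ω} ≤ ENNReal.ofReal (1 / (ε * √(m * v) - l) ^ 2) := by
  have hm' : (0 : ℝ) < m := by exact_mod_cast hm
  set x := 1 - v with hx
  set p := x + ε * (1 - x) with hp
  have hp0 : 0 ≤ p := add_nonneg (by linarith) (mul_nonneg hε0 (by linarith))
  have hp1 : p ≤ 1 := by nlinarith
  have hζ := h.measurable_ζ
  have hae : ∀ᵐ ω ∂μ, ∀ i, ζ i ω ∈ Set.Ioo (0 : ℝ) 1 := by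
    have h1 := CondIndepLaw.measure_iInter h (B := fun _ => Set.Ioo (0 : ℝ) 1) (b := fun _ => 1)
      (fun _ => measurableSet_Ioo) fun t => by
        filter_upwards [hP t] with ω hω
        exact mixLaw_eq_one hε0 hε1 hω.1 (by linarith [hω.2]) subset_rfl
    rw [Finset.prod_const_one] at h1
    have h2 : ∀ᵐ ω ∂μ, ω ∈ ⋂ t, ζ t ⁻¹' Set.Ioo (0 : ℝ) 1 :=
      (mem_ae_iff_prob_eq_one (MeasurableSet.iInter fun t => hζ t measurableSet_Ioo)).2 h1
    filter_upwards [h2] with ω hω i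
    exact Set.mem_iInter.1 hω i
  let s : Fin m → Set Ω := fun t => ζ t ⁻¹' Set.Iic x
  have hs : ∀ t, MeasurableSet (s t) := fun t => hζ t measurableSet_Iic
  -- Since x exceeds every green mass, the conditional probability of ζ_t ≤ x is the constant p;
  -- this yields genuine independence of the events `s t`.
  have hbi : ∀ S : Finset (Fin m), μ (⋂ t ∈ S, s t) = ∏ _t ∈ S, ENNReal.ofReal p := by
    intro S
    have h1 := CondIndepLaw.measure_iInter h (B := fun t => if t ∈ S then Set.Iic x else Set.univ)
      (b := fun t => if t ∈ S then ENNReal.ofReal p else 1)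
      (fun t => by split_ifs; exacts [measurableSet_Iic, MeasurableSet.univ]) fun t => by
        filter_upwards [hP t] with ω hω
        split_ifs
        · exact mixLaw_Iic hε0 hε1 hω.1 hω.2.le (by linarith)
        · exact mixLaw_eq_one hε0 hε1 hω.1 (by linarith [hω.2]) (Set.subset_univ _)
    have e : (⋂ t, ζ t ⁻¹' if t ∈ S then Set.Iic x else Set.univ) = ⋂ t ∈ S, s t := by
      ext ω
      simp only [Set.mem_iInter, s]
      refine forall_congr' fun t => ?_
      by_cases ht : t ∈ S <;> simp [ht]
    rw [e] at h1
    rw [h1, Finset.prod_ite_mem, Finset.univ_inter]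
  have hμs : ∀ t, μ (s t) = ENNReal.ofReal p := fun t => by simpa using hbi {t}
  have hind : iIndepSet s μ := (iIndepSet_iff_meas_biInter hs).2 fun S => by
    rw [hbi S]
    exact Finset.prod_congr rfl fun t _ => (hμs t).symm
  set r := √(m * v) with hr
  have hr0 : 0 < r := Real.sqrt_pos.2 (by positivity)
  have hr2 : r ^ 2 = m * v := Real.sq_sqrt (by positivity)
  -- This deviation is the gap between the mean mp and mx + lr, a level above the boundary at x
  -- since √(mx(1-x)) ≤ r.
  have hd : 0 < r * (ε * r - l) := mul_pos hr0 (by linarith)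
  have hch := measure_sum_indicator_le hs hind hp0 hp1 hμs hd
  refine le_trans (measure_mono_ae ?_) (hch.trans (ENNReal.ofReal_le_ofReal ?_))
  · filter_upwards [hae] with ω hω hnot
    change ∑ t, (s t).indicator (fun _ => (1 : ℝ)) ω ≤ m * p - r * (ε * r - l)
    have hcount : ∑ t, (s t).indicator (fun _ => (1 : ℝ)) ω = countLE (fun t => ζ t ω) x := by
      have e : ∀ t, (s t).indicator (fun _ => (1 : ℝ)) ω = if ζ t ω ≤ x then 1 else 0 :=
        fun t => by by_cases ht : ζ t ω ≤ x <;> simp [s, ht]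
      simp [countLE, e]
    rw [hcount]
    by_contra! hgt
    refine hnot (le_hcStat_of_countLE (x := x) hω hl ⟨by linarith, by linarith⟩ ?_ hm)
    have h1 : √(m * (x * (1 - x))) ≤ r := by
      refine Real.sqrt_le_sqrt ?_
      gcongr
      rw [hx]
      nlinarith
    have h2 : l * √(m * (x * (1 - x))) ≤ l * r := by gcongr
    have h3 : m * p - r * (ε * r - l) = m * x + l * r := by
      have : r * (ε * r - l) = ε * r ^ 2 - l * r := by ring
      rw [this, hr2, hp, hx]
      ring
    linarith
  · have h1 : m * (1 - p) ≤ r ^ 2 := by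
      rw [hr2]
      gcongr
      have := mul_nonneg hε0 (by linarith : 0 ≤ 1 - x)
      rw [hp]
      linarith
    calc m * (1 - p) / (r * (ε * r - l)) ^ 2 ≤ r ^ 2 / (r * (ε * r - l)) ^ 2 := by gcongr
      _ = 1 / (ε * r - l) ^ 2 := by
        rw [mul_pow, ← div_div, div_self (by positivity)]

/-! ### Signal against threshold, and conclusion -/

lemma tendsto_rpow_sub_hcThreshold {γ δ : ℝ} (hγ : 0 < γ) (hδ : 0 < δ) :
    Tendsto (fun m : ℕ => (m : ℝ) ^ γ - hcThreshold δ m) atTop atTop := by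
  have hX : Tendsto (fun m : ℕ => √((m : ℝ) ^ γ)) atTop atTop :=
    Real.tendsto_sqrt_atTop.comp ((tendsto_rpow_atTop hγ).comp tendsto_natCast_atTop_atTop)
  set C := √((2 + δ) / γ)
  -- Since log log m ≤ log m ≤ m^γ/γ, the threshold is at most C√(m^γ), which leaves this product as
  -- a lower bound.
  have h : Tendsto (fun m : ℕ => √((m : ℝ) ^ γ) * (√((m : ℝ) ^ γ) - C)) atTop atTop :=
    hX.atTop_mul_atTop₀ (tendsto_atTop_add_const_right _ (-C) hX)
  refine tendsto_atTop_mono' _ ?_ h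
  filter_upwards [eventually_gt_atTop 1] with m hm
  have hm1 : (1 : ℝ) < m := by exact_mod_cast hm
  have hlog : 0 < Real.log m := Real.log_pos hm1
  have h1 : Real.log (Real.log m) ≤ (m : ℝ) ^ γ / γ :=
    (Real.log_le_self hlog.le).trans (Real.log_le_rpow_div (by linarith) hγ)
  have h2 : hcThreshold δ m ≤ C * √((m : ℝ) ^ γ) := by
    rw [← Real.sqrt_mul (by positivity)]
    refine Real.sqrt_le_sqrt ?_
    calc (2 + δ) * Real.log (Real.log m) ≤ (2 + δ) * ((m : ℝ) ^ γ / γ) := by gcongr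
      _ = _ := by ring
  have h3 : √((m : ℝ) ^ γ) * √((m : ℝ) ^ γ) = (m : ℝ) ^ γ :=
    Real.mul_self_sqrt (by positivity)
  rw [mul_sub, h3]
  linarith

theorem mainTheorem1 {W : Type*} [Fintype W]
    (p q : ℝ) (hp : 0 < p) (hp1 : p < 1) (hq : 0 < q) (hq1 : q < 1) (hpq : q + 2 * p < 1)
    (Ω : ℕ → Type*) [∀ m, MeasurableSpace (Ω m)]
    (P : ∀ m, Fin m → Ω m → stdSimplex ℝ W)
    (G : ∀ m, Fin m → Ω m → Finset W)
    (ζ : ∀ m, Fin m → Ω m → ℝ)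
    (μ₀ μ₁ : ∀ m, Measure (Ω m))
    [∀ m, IsProbabilityMeasure (μ₀ m)] [∀ m, IsProbabilityMeasure (μ₁ m)]
    (hH₀ : ∀ m : ℕ, NullHyp (μ₀ m) (P m) (G m) (ζ m))
    (hH₁ : ∀ m : ℕ, MixHyp ((m : ℝ) ^ (-p)) (μ₁ m) (P m) (G m) (ζ m))
    (hP : ∀ᶠ m : ℕ in atTop, ∀ t : Fin m, ∀ᵐ ω ∂(μ₁ m),
      0 < greenMass (P m t ω) (G m t ω) ∧
        greenMass (P m t ω) (G m t ω) < 1 - (m : ℝ) ^ (-q))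
    (δ : ℝ) (hδ : 0 < δ) :
    Tendsto
      (fun m : ℕ =>
        μ₀ m {ω | hcThreshold δ m ≤ hcStat (fun t => ζ m t ω)} +
        μ₁ m {ω | ¬ hcThreshold δ m ≤ hcStat (fun t => ζ m t ω)})
      atTop (𝓝 0) := by
  have hnull : Tendsto (fun m : ℕ => μ₀ m {ω | hcThreshold δ m ≤ hcStat (fun t => ζ m t ω)})
      atTop (𝓝 0) := by
    refine tendsto_of_tendsto_of_tendsto_of_le_of_le' tendsto_const_nhds
      (tendsto_pi_exists_standardized hδ) (Eventually.of_forall fun _ => zero_le) ?_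
    filter_upwards [eventually_gt_atTop 0] with m hm
    exact (hH₀ m).measure_le hm _
  have halt : Tendsto (fun m : ℕ => μ₁ m {ω | ¬ hcThreshold δ m ≤ hcStat (fun t => ζ m t ω)})
      atTop (𝓝 0) := by
    set γ := (1 - q - 2 * p) / 2 with hγdef
    have hγ : 0 < γ := by rw [hγdef]; linarith
    have hT := tendsto_rpow_sub_hcThreshold hγ hδ
    have hlim : Tendsto (fun m : ℕ => ENNReal.ofReal (1 / ((m : ℝ) ^ γ - hcThreshold δ m) ^ 2))
        atTop (𝓝 0) := by
      have h := ENNReal.tendsto_ofReal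
        (tendsto_inv_atTop_zero.comp ((tendsto_pow_atTop two_ne_zero).comp hT))
      simpa [Function.comp_def] using h
    refine tendsto_of_tendsto_of_tendsto_of_le_of_le' tendsto_const_nhds hlim
      (Eventually.of_forall fun _ => zero_le) ?_
    filter_upwards [hP, eventually_gt_atTop 1, hT.eventually_gt_atTop 0] with m hPm hm hTm
    have hm1 : (1 : ℝ) < m := by exact_mod_cast hm
    have hm0 : (0 : ℝ) < m := by linarith
    have hsig : (m : ℝ) ^ (-p) * √(m * (m : ℝ) ^ (-q)) = (m : ℝ) ^ γ := by
      have e : (m : ℝ) * (m : ℝ) ^ (-q) = (m : ℝ) ^ (1 - q) := by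
        rw [sub_eq_add_neg, Real.rpow_add hm0, Real.rpow_one]
      rw [e, Real.sqrt_eq_rpow, ← Real.rpow_mul hm0.le, ← Real.rpow_add hm0, hγdef]
      congr 1
      ring
    have h := (hH₁ m).measure_le (l := hcThreshold δ m) (v := (m : ℝ) ^ (-q)) (by omega)
      (Real.rpow_nonneg hm0.le _) (Real.rpow_le_one_of_one_le_of_nonpos hm1.le (by linarith))
      (Real.rpow_pos_of_pos hm0 _) (Real.rpow_lt_one_of_one_lt_of_neg hm1 (by linarith)) hPm
      (Real.sqrt_nonneg _) (by rw [hsig]; linarith)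
    rwa [hsig] at h
  simpa using hnull.add halt
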